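/- Let $k\ge 1$, $n\ge 2$, $[m]=\{1,\dots,m\}$. Let $F=([k],E_F)$ be a directed tree rooted at node $1$, without loops: node $1$ has no incoming edge and every $i\ge 2$ has exactly one incoming edge $(i^-,i)\in E_F$, the nodes being ordered so that $i^-<i$. Let $\mathcal G=([n],A,\alpha)$ be a network, i.e. $A:[n]^2\to[0,\infty)$ and $\alpha:[n]\to(0,1]$ is a probability vector, such that every $a\in[n]$ has some $b$ with $A(a,b)>0$. Define on $[n]^{[k]}$ the probability distribution $$\pi_{F\to\mathcal G}(\mathbf x)=\frac1{\mathtt Z}\prod_{(i,j)\in E_F}A(\mathbf x(i),\mathbf x(j))\;\prod_{i=1}^k\alpha(\mathbf x(i)),$$ with $\mathtt Z$ the normalizing constant, and call $\mathbf x$ a homomorphism if $\pi_{F\to\mathcal G}(\mathbf x)>0$. Let $\pi^{(1)}(a)=\pi_{F\to\mathcal G}(\mathbf x(1)=a)$ be the marginal at the root, let $$\Psi(a,b)=\frac{\alpha(a)\max(A(a,b),A(b,a))\,\alpha(b)}{\sum_{c}\alpha(a)\max(A(a,c),A(c,a))\,\alpha(c)},$$ and assume that $\mathcal G$ is irreducible,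 i.e. the Markov chain on $[n]$ with kernel $\Psi$ is irreducible. Let $P$ be its Metropolis–Hastings modification: for $b\ne a$, $$P(a,b)=\Psi(a,b)\min\Big(\frac{\pi^{(1)}(b)\Psi(b,a)}{\pi^{(1)}(a)\Psi(a,b)},1\Big)\quad(\text{and }P(a,b)=0\text{ if }\Psi(a,b)=0),\qquad P(a,a)=1-\sum_{c\neq a}P(a,c).$$ The pivot chain $(\mathbf x_t)_{t\ge0}$ is the Markov chain of homomorphisms $F\to\mathcal G$, started from an arbitrary (possibly random) homomorphism $\mathbf x_0$, in which at each step the root location $\mathbf x_t(1)$ moves to $\mathbf x_{t+1}(1)$ according to $P$, and then $\mathbf x_{t+1}(2),\dots,\mathbf x_{t+1}(k)$ are sampled from $\pi_{F\to\mathcal G}$ conditioned on the root location $\mathbf x_{t+1}(1)$. Let $$t^{(1)}_{mix}(\varepsilon)=\inf\Big\{t\ge0:\max_{a\in[n]}\tfrac12\sum_{b\in[n]}|P^t(a,b)-\pi^{(1)}(b)|\le\varepsilon\Big\}\in\{0,1,2,\dots\}\cup\{\infty\}$$ be the mixing time of the pivot $\mathbf x_t(1)$. **Theorem.** Let $g:[n]^{[k]}\to\mathbb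 R$ be any functional and let $c>0$ satisfy $|g(\mathbf x)-g(\mathbf y)|\le c$ for all homomorphisms $\mathbf x,\mathbf y:F\to\mathcal G$. Then for every $\delta>0$ and every integer $N\ge1$, $$\mathbb P\left(\left|\mathbb E_{\pi_{F\to\mathcal G}}[g(\mathbf x)]-\frac1N\sum_{t=1}^N g(\mathbf x_t)\right|\ge\delta\right)<2\exp\left(\frac{-2\delta^2N}{9\,c^2\,t^{(1)}_{mix}(1/4)}\right),$$ where the right-hand side is read as $2$ if $t^{(1)}_{mix}(1/4)=\infty$. In particular, if $g$ has oscillation at most $1$ on homomorphisms (e.g. $g$ takes values in $[0,1]$), one may take $c=1$. -/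

import Mathlib

open scoped BigOperators

namespace PivotChain

/-- A network on the node set `Fin n`: a matrix of nonnegative interaction strengths and a
strictly positive probability vector of node weights. -/
structure Network (n : ℕ) where
  A : Fin n → Fin n → ℝ
  α : Fin n → ℝ
  A_nonneg : ∀ a b, 0 ≤ A a b
  α_pos : ∀ a, 0 < α a
  α_sum : ∑ a, α a = 1

/-- A motif on the node set `Fin k`: a nonnegative matrix of edge weights. -/
structure Motif (k : ℕ) where
  A : Fin k → Fin k → ℝ
  A_nonneg : ∀ i j, 0 ≤ A i j

/-- `F` is (the 0-1 edge matrix of) a directed tree rooted at the first node `0`, without loops,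
with nodes listed so that the parent `i⁻` of each node `i ≠ 0` satisfies `i⁻ < i`. -/
def Motif.IsRootedTree {k : ℕ} [NeZero k] (F : Motif k) : Prop :=
  (∀ i j, F.A i j = 0 ∨ F.A i j = 1) ∧
  (∀ j, F.A j 0 = 0) ∧
  ∀ i, i ≠ 0 → ∃ p, p < i ∧ ∀ j, 0 < F.A j i ↔ j = p

noncomputable section

/-- The unnormalized weight
`(∏_{i,j} A(x(i), x(j)) ^ A_F(i,j)) α(x(1)) ⋯ α(x(k))` of a vertex map `x : [k] → [n]`,
with `0 ^ 0 = 1`. -/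
def homWeight {k n : ℕ} (F : Motif k) (G : Network n) (x : Fin k → Fin n) : ℝ :=
  (∏ i, ∏ j, G.A (x i) (x j) ^ F.A i j) * ∏ i, G.α (x i)

/-- The homomorphism density `t(F, G)`, the normalizing constant. -/
def homDensity {k n : ℕ} (F : Motif k) (G : Network n) : ℝ :=
  ∑ x : Fin k → Fin n, homWeight F G x

/-- The probability distribution `π_{F → G}` on vertex maps `[k] → [n]`. -/
def homDist {k n : ℕ} (F : Motif k) (G : Network n) (x : Fin k → Fin n) : ℝ :=
  homWeight F G x / homDensity F G

/-- A homomorphism `F → G` is a vertex map charged by `π_{F → G}`. -/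
def IsHom {k n : ℕ} (F : Motif k) (G : Network n) (x : Fin k → Fin n) : Prop :=
  0 < homDist F G x

/-- The expectation of `g` under `π_{F → G}`. -/
def homMean {k n : ℕ} (F : Motif k) (G : Network n) (g : (Fin k → Fin n) → ℝ) : ℝ :=
  ∑ x, homDist F G x * g x

/-- The marginal `π⁽¹⁾` of `π_{F → G}` at the location of the root. -/
def rootMarginal {k n : ℕ} [NeZero k] (F : Motif k) (G : Network n) (a : Fin n) : ℝ :=
  ∑ x with x 0 = a, homDist F G x

/-- The random walk kernel `Ψ` on the network. -/
def walkKernel {n : ℕ} (G : Network n) : Matrix (Fin n) (Fin n) ℝ := fun a b =>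
  G.α a * max (G.A a b) (G.A b a) * G.α b /
    ∑ c, G.α a * max (G.A a c) (G.A c a) * G.α c

/-- The network is irreducible if the random walk with kernel `Ψ`, started anywhere, reaches
every node with positive probability. -/
def Network.IsIrreducible {n : ℕ} (G : Network n) : Prop :=
  ∀ a b, ∃ t : ℕ, 0 < (walkKernel G ^ t) a b

/-- The Metropolis-Hastings acceptance probability `λ` of a move `a ↦ b`. -/
def acceptProb {k n : ℕ} [NeZero k] (F : Motif k) (G : Network n) (a b : Fin n) : ℝ :=
  min (rootMarginal F G b * walkKernel G b a / (rootMarginal F G a * walkKernel G a b)) 1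

/-- The transition kernel `P` of the pivot: propose according to `Ψ`, accept with
probability `λ`. -/
def rootKernel {k n : ℕ} [NeZero k] (F : Motif k) (G : Network n) :
    Matrix (Fin n) (Fin n) ℝ := fun a b =>
  if b = a then 1 - ∑ c with c ≠ a, walkKernel G a c * acceptProb F G a c
  else walkKernel G a b * acceptProb F G a b

/-- The transition kernel of the pivot chain: the root moves according to `P`, and then the
other nodes are sampled from `π_{F → G}` conditioned on the new location of the root. -/
def chainKernel {k n : ℕ} [NeZero k] (F : Motif k) (G : Network n)
    (x y : Fin k → Fin n) : ℝ :=
  rootKernel F G (x 0) (y 0) * (homDist F G y / rootMarginal F G (y 0))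

/-- Total variation distance on a finite set. -/
def tvDist {S : Type*} [Fintype S] (μ ν : S → ℝ) : ℝ :=
  1 / 2 * ∑ s, |μ s - ν s|

/-- The mixing time `inf {t ≥ 0 : max_x ‖P^t(x, ·) - π‖_TV ≤ ε}` of a transition matrix `P` with
stationary distribution `π`; it is `⊤` when there is no such `t`. -/
def mixingTime {S : Type*} [Fintype S] [DecidableEq S] (P : Matrix S S ℝ) (π : S → ℝ)
    (ε : ℝ) : ℕ∞ :=
  ⨅ t ∈ {t : ℕ | ∀ x, tvDist ((P ^ t) x) π ≤ ε}, (t : ℕ∞)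

end

/-- `X` is a time-homogeneous Markov chain with transition probabilities `K`: given the history
`X 0 = x 0, …, X t = x t`, the next state is `x (t+1)` with probability `K (x t) (x (t+1))`. -/
def IsMarkovChain {S Ω : Type*} [MeasurableSpace Ω] (μ : MeasureTheory.Measure Ω)
    (K : S → S → ℝ) (X : ℕ → Ω → S) : Prop :=
  ∀ (t : ℕ) (x : ℕ → S),
    μ.real {ω | ∀ s ≤ t + 1, X s ω = x s} =
      μ.real {ω | ∀ s ≤ t, X s ω = x s} * K (x t) (x (t + 1))

end PivotChain

/-!
Cut `1, …, N` into blocks of length `τ = t_mix(1/4)`. After `τ` steps the laws of two pivots are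
within `1/4` of stationarity, hence within `1/2` of each other in total variation. The other nodes
are resampled given the pivot, so the same holds for the whole chain: `τ` steps halve the
oscillation of every function of the state. Consequently the conditional mean of the sum over the
future blocks, as a function of the current state, has oscillation below `2 τ c`; adding the `τ`
terms of the current block, Hoeffding's lemma applies to a variable of oscillation below `3 τ c`.
Multiplying the resulting conditional moment generating function bounds over `N / τ` blocks gives
the variance proxy `9 N τ c² / 4`, and Chernoff's bound the exponent `2 δ² N / (9 c² τ)`.
The chain is not started from stationarity; the resulting bias is at most `2 τ c` and is absorbed
by the last blocks, which have little future ahead of them and hence a smaller oscillation.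
-/

namespace PivotChain

open MeasureTheory ProbabilityTheory Matrix

section Oscillation

/-- The oscillation of `h` is at most `o`. A bound on differences, rather than on a supremum,
avoids the junk value of `⨆` on unbounded families. -/
def OscLE {α : Type*} (h : α → ℝ) (o : ℝ) : Prop :=
  ∀ x y, h x - h y ≤ o

theorem OscLE.add {α : Type*} {h h' : α → ℝ} {o o' : ℝ} (hh : OscLE h o) (hh' : OscLE h' o') :
    OscLE (h + h') (o + o') := fun x y => by
  simpa only [Pi.add_apply, add_sub_add_comm] using add_le_add (hh x y) (hh' x y)

theorem OscLE.comp {α β : Type*} {h : α → ℝ} {o : ℝ} (hh : OscLE h o) (u : β → α) :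
    OscLE (fun b => h (u b)) o := fun x y => hh (u x) (u y)

theorem OscLE.sum {ι α : Type*} {h : ι → α → ℝ} {c : ℝ} (s : Finset ι)
    (hh : ∀ i, OscLE (h i) c) : OscLE (fun x => ∑ i ∈ s, h i x) (s.card * c) := fun x y => by
  rw [← Finset.sum_sub_distrib, ← nsmul_eq_mul]
  exact Finset.sum_le_card_nsmul _ _ _ fun i _ => hh i x y

theorem OscLE.exists_forall_mem_Icc {α : Type*} {h : α → ℝ} {o : ℝ} (hh : OscLE h o) :
    ∃ a, ∀ x, h x ∈ Set.Icc a (a + o) := by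
  rcases isEmpty_or_nonempty α with _ | ⟨⟨x₀⟩⟩
  · exact ⟨0, isEmptyElim⟩
  have hbdd : BddBelow (Set.range h) :=
    ⟨h x₀ - o, Set.forall_mem_range.2 fun x => by linarith [hh x₀ x]⟩
  have : Nonempty α := ⟨x₀⟩
  refine ⟨⨅ x, h x, fun x => ⟨ciInf_le hbdd x, ?_⟩⟩
  rw [← sub_le_iff_le_add]
  exact le_ciInf fun y => by linarith [hh x y]

theorem exists_oscLE_eqOn {α : Type*} {s : Set α} (hs : s.Nonempty) {f : α → ℝ} {c : ℝ}
    (hf : ∀ x ∈ s, ∀ y ∈ s, f x - f y ≤ c) : ∃ f', OscLE f' c ∧ Set.EqOn f' f s := by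
  classical
  obtain ⟨x₀, hx₀⟩ := hs
  let r : α → α := fun x => if x ∈ s then x else x₀
  have hr : ∀ x, r x ∈ s := fun x => by
    by_cases hx : x ∈ s <;> simp [r, hx, hx₀]
  exact ⟨f ∘ r, fun x y => hf _ (hr x) _ (hr y), fun x hx => by simp [r, hx]⟩

variable {S : Type*} [Fintype S] {p q r h : S → ℝ} {o : ℝ}

theorem tvDist_le_add (p q r : S → ℝ) : tvDist p q ≤ tvDist p r + tvDist q r := by
  simp only [tvDist, ← mul_add, ← Finset.sum_add_distrib]
  gcongr with s
  rw [abs_sub_comm (q s)]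
  exact abs_sub_le _ _ _

theorem tvDist_le_one (hp : p ∈ stdSimplex ℝ S) (hq : q ∈ stdSimplex ℝ S) : tvDist p q ≤ 1 :=
  calc tvDist p q ≤ 1 / 2 * ∑ s, (p s + q s) := by
        unfold tvDist
        gcongr with s
        exact (abs_sub _ _).trans_eq (by rw [abs_of_nonneg (hp.1 s), abs_of_nonneg (hq.1 s)])
    _ = 1 := by rw [Finset.sum_add_distrib, hp.2, hq.2]; norm_num

theorem OscLE.dotProduct_sub_le_tvDist_mul (hh : OscLE h o) (hpq : ∑ x, p x = ∑ x, q x) :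
    p ⬝ᵥ h - q ⬝ᵥ h ≤ tvDist p q * o := by
  obtain ⟨a, ha⟩ := hh.exists_forall_mem_Icc
  have hcenter : ∀ x, |h x - (a + o / 2)| ≤ o / 2 := fun x => by
    rw [abs_le]; constructor <;> linarith [(ha x).1, (ha x).2]
  calc p ⬝ᵥ h - q ⬝ᵥ h = ∑ x, (p x - q x) * (h x - (a + o / 2)) := by
        simp only [dotProduct, sub_mul, mul_sub, Finset.sum_sub_distrib, ← Finset.sum_mul, hpq]
        ring
    _ ≤ ∑ x, |p x - q x| * (o / 2) := Finset.sum_le_sum fun x _ =>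
        (le_abs_self _).trans (by rw [abs_mul]; gcongr; exact hcenter x)
    _ = tvDist p q * o := by rw [← Finset.sum_mul, tvDist]; ring

theorem OscLE.dotProduct_sub_le (hh : OscLE h o) (hp : p ∈ stdSimplex ℝ S)
    (hq : q ∈ stdSimplex ℝ S) : p ⬝ᵥ h - q ⬝ᵥ h ≤ o := by
  obtain ⟨x⟩ : Nonempty S := by
    by_contra hS
    simp [not_nonempty_iff.1 hS, stdSimplex_of_isEmpty_index] at hp
  have ho : 0 ≤ o := by simpa using hh x x
  exact (hh.dotProduct_sub_le_tvDist_mul (hp.2.trans hq.2.symm)).trans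
    (mul_le_of_le_one_left ho (tvDist_le_one hp hq))

variable [DecidableEq S] {K : Matrix S S ℝ}

theorem row_mem_stdSimplex (hK : K ∈ rowStochastic ℝ S) (x : S) : K x ∈ stdSimplex ℝ S :=
  ⟨fun _ => nonneg_of_mem_rowStochastic hK, sum_row_of_mem_rowStochastic hK x⟩

theorem OscLE.mulVec (hh : OscLE h o) (hK : K ∈ rowStochastic ℝ S) : OscLE (K *ᵥ h) o :=
  fun x y => hh.dotProduct_sub_le (row_mem_stdSimplex hK x) (row_mem_stdSimplex hK y)

/-- Application of `M` halves oscillations: Dobrushin's contraction coefficient of `M` is at most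
`1 / 2`. -/
def HalvesOsc (M : Matrix S S ℝ) : Prop :=
  ∀ ⦃h : S → ℝ⦄ ⦃o : ℝ⦄, OscLE h o → OscLE (M *ᵥ h) (o / 2)

theorem halvesOsc_of_tvDist_le (hK : K ∈ rowStochastic ℝ S)
    (hq : ∀ x, tvDist (K x) q ≤ 1 / 4) :
    HalvesOsc K := fun h o hh x y => by
  have ho : 0 ≤ o := by simpa using hh x x
  have hxy : tvDist (K x) (K y) ≤ 1 / 2 := by
    linarith [tvDist_le_add (K x) (K y) q, hq x, hq y]
  calc (K *ᵥ h) x - (K *ᵥ h) y ≤ tvDist (K x) (K y) * o :=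
        hh.dotProduct_sub_le_tvDist_mul
          ((row_mem_stdSimplex hK x).2.trans (row_mem_stdSimplex hK y).2.symm)
    _ ≤ 1 / 2 * o := by gcongr
    _ = o / 2 := by ring

end Oscillation

section Deviation

variable {Ω : Type*} [MeasurableSpace Ω] {μ : Measure Ω} [IsProbabilityMeasure μ] {Z : Ω → ℝ}

theorem OscLE.integrable {o : ℝ} (ho : OscLE Z o) (hZ : Measurable Z) : Integrable Z μ := by
  obtain ⟨a, ha⟩ := ho.exists_forall_mem_Icc
  exact .of_mem_Icc a (a + o) hZ.aemeasurable (.of_forall ha)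

theorem OscLE.integrable_exp_mul {o : ℝ} (ho : OscLE Z o) (hZ : Measurable Z) (l : ℝ) :
    Integrable (fun ω => Real.exp (l * Z ω)) μ := by
  obtain ⟨a, ha⟩ := ho.exists_forall_mem_Icc
  exact integrable_exp_mul_of_mem_Icc hZ.aemeasurable (.of_forall ha)

theorem OscLE.mgf_le {o : ℝ} (ho : OscLE Z o) (hZ : Measurable Z) (l : ℝ) :
    mgf Z μ l ≤ Real.exp (l * μ[Z] + l ^ 2 * o ^ 2 / 8) := by
  obtain ⟨a, ha⟩ := ho.exists_forall_mem_Icc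
  have hoeffding := (hasSubgaussianMGF_of_mem_Icc (μ := μ) hZ.aemeasurable
    (.of_forall ha)).mgf_le l
  have hcenter : mgf Z μ l = Real.exp (l * μ[Z]) * mgf (fun ω => Z ω - μ[Z]) μ l := by
    simp only [sub_eq_add_neg, mgf_add_const]
    rw [mul_left_comm, ← Real.exp_add, mul_neg, add_neg_cancel, Real.exp_zero, mul_one]
  rw [hcenter, Real.exp_add]
  gcongr
  refine hoeffding.trans_eq ?_
  simp only [add_sub_cancel_left, div_pow, NNReal.coe_div, NNReal.coe_pow, coe_nnnorm,
    Real.norm_eq_abs, sq_abs, NNReal.coe_ofNat, Real.exp_eq_exp]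
  ring

/-- The two tails contribute `exp (l * b)` and `exp (-l * b)`, where `b` is the difference between
the mean `e` of `Z` and `m`; their sum is `2 cosh (l b)`, at most `2 exp (l² b² / 2)`. -/
theorem measureReal_le_abs_sub_le {e m b V : ℝ}
    (hint : ∀ l, Integrable (fun ω => Real.exp (l * Z ω)) μ)
    (hmgf : ∀ l, mgf Z μ l ≤ Real.exp (l * e + l ^ 2 * V / 8)) (hb : |e - m| ≤ b)
    (d : ℝ) {l : ℝ} (hl : 0 ≤ l) :
    μ.real {ω | d ≤ |Z ω - m|} ≤ 2 * Real.exp (-l * d + l ^ 2 * (V + 4 * b ^ 2) / 8) := by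
  have hsplit : {ω | d ≤ |Z ω - m|} ⊆ {ω | m + d ≤ Z ω} ∪ {ω | Z ω ≤ m - d} := fun ω hω =>
    (le_abs.1 (show d ≤ |Z ω - m| from hω)).imp (fun h => show m + d ≤ Z ω by linarith)
      fun h => show Z ω ≤ m - d by linarith
  have hbias : (e - m) ^ 2 ≤ b ^ 2 := sq_le_sq' (abs_le.1 hb).1 (abs_le.1 hb).2
  calc μ.real {ω | d ≤ |Z ω - m|}
      ≤ μ.real {ω | m + d ≤ Z ω} + μ.real {ω | Z ω ≤ m - d} :=
        (measureReal_mono hsplit).trans (measureReal_union_le _ _)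
    _ ≤ Real.exp (-l * (m + d)) * Real.exp (l * e + l ^ 2 * V / 8) +
        Real.exp (-(-l) * (m - d)) * Real.exp (-l * e + (-l) ^ 2 * V / 8) := by
        gcongr
        · exact (measure_ge_le_exp_mul_mgf _ hl (hint l)).trans (by gcongr; exact hmgf l)
        · exact (measure_le_le_exp_mul_mgf _ (neg_nonpos.2 hl) (hint _)).trans
            (by gcongr; exact hmgf (-l))
    _ = 2 * (Real.exp (-l * d + l ^ 2 * V / 8) * Real.cosh (l * (e - m))) := by
        rw [Real.cosh_eq, mul_left_comm, mul_div_cancel₀ _ two_ne_zero, mul_add (Real.exp _)]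
        simp only [← Real.exp_add]
        congr 2 <;> ring
    _ ≤ 2 * (Real.exp (-l * d + l ^ 2 * V / 8) * Real.exp ((l * (e - m)) ^ 2 / 2)) := by
        gcongr
        exact Real.cosh_le_exp_half_sq _
    _ ≤ 2 * Real.exp (-l * d + l ^ 2 * (V + 4 * b ^ 2) / 8) := by
        rw [← Real.exp_add]
        refine mul_le_mul_of_nonneg_left (Real.exp_le_exp.2 ?_) zero_le_two
        nlinarith [mul_le_mul_of_nonneg_left hbias (sq_nonneg l)]

end Deviation

section MarkovChain

variable {S Ω : Type*} [MeasurableSpace Ω] {μ : Measure Ω} {K : S → S → ℝ} {X : ℕ → Ω → S}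

theorem IsMarkovChain.measureReal_one_eq [IsProbabilityMeasure μ] (hX : IsMarkovChain μ K X)
    {x : S} (hx : ∀ᵐ ω ∂μ, X 0 ω = x) (y : S) : μ.real {ω | X 1 ω = y} = K x y := by
  have hstart : μ.real {ω | ∀ s ≤ 0, X s ω = if s = 0 then x else y} = 1 :=
    (measureReal_congr (ae_eq_univ.2 (hx.mono (by simp)))).trans probReal_univ
  have hstep := hX 0 fun s => if s = 0 then x else y
  rw [hstart, one_mul] at hstep
  refine (measureReal_congr (Filter.eventuallyEq_set.2 ?_)).trans hstep
  filter_upwards [hx] with ω hω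
  refine ⟨fun h s hs => ?_, fun h => h 1 le_rfl⟩
  obtain rfl | rfl := Nat.le_one_iff_eq_zero_or_eq_one.1 hs
  exacts [hω, h]

variable [MeasurableSpace S] [MeasurableSingletonClass S]

theorem measurableSet_path_eq (hXm : ∀ t, Measurable (X t)) (t : ℕ) (x : ℕ → S) :
    MeasurableSet {ω | ∀ s ≤ t, X s ω = x s} := by
  measurability

theorem IsMarkovChain.cond (hX : IsMarkovChain μ K X) (hXm : ∀ t, Measurable (X t)) (t : ℕ)
    (x : ℕ → S) : IsMarkovChain μ[|{ω | ∀ s ≤ t, X s ω = x s}] K fun s => X (t + s) := by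
  intro u y
  have hcond : ∀ B, μ[|{ω | ∀ s ≤ t, X s ω = x s}].real B =
      (μ.real {ω | ∀ s ≤ t, X s ω = x s})⁻¹ * μ.real ({ω | ∀ s ≤ t, X s ω = x s} ∩ B) := fun B => by
    rw [measureReal_def, cond_apply (measurableSet_path_eq hXm t x), ENNReal.toReal_mul,
      ENNReal.toReal_inv, measureReal_def, measureReal_def]
  rw [hcond, hcond, mul_assoc]
  congr 1
  by_cases hy : y 0 = x t
  · have hconcat : ∀ v, {ω | ∀ s ≤ t, X s ω = x s} ∩ {ω | ∀ s ≤ v, X (t + s) ω = y s} =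
        {ω | ∀ s ≤ t + v, X s ω = if s ≤ t then x s else y (s - t)} := fun v => by
      ext ω
      constructor
      · rintro ⟨hpast, hfuture⟩ s hs
        split_ifs with h
        · exact hpast s h
        · simpa [Nat.add_sub_of_le (not_le.1 h).le] using hfuture (s - t) (by omega)
      · refine fun h => ⟨fun s hs => by simpa [hs] using h s (by omega), fun s hs => ?_⟩
        rcases s.eq_zero_or_pos with rfl | hpos
        · simpa [hy] using h t (by omega)
        · simpa [hpos.ne'] using h (t + s) (by omega)
    have hstep := hX (t + u) fun s => if s ≤ t then x s else y (s - t)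
    rw [hconcat, hconcat, ← add_assoc, hstep]
    rcases u.eq_zero_or_pos with rfl | hpos
    · simp [hy]
    · simp [hpos.ne', add_assoc]
  · have hempty : ∀ v, {ω | ∀ s ≤ t, X s ω = x s} ∩ {ω | ∀ s ≤ v, X (t + s) ω = y s} = ∅ :=
      fun v => Set.eq_empty_of_forall_notMem fun ω h =>
        hy ((h.2 0 v.zero_le).symm.trans (h.1 t le_rfl))
    rw [hempty, hempty, measureReal_empty, zero_mul]

section Finite

variable [Finite S]

theorem integrable_comp {Y : Ω → S} [IsFiniteMeasure μ] (hY : Measurable Y) (φ : S → ℝ) :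
    Integrable (fun ω => φ (Y ω)) μ :=
  (Integrable.of_finite (f := φ)).comp_measurable hY

/-- Law of total expectation, by conditioning on the first `t + 1` states. -/
theorem IsMarkovChain.integral_mono_of_cond [IsFiniteMeasure μ] (hX : IsMarkovChain μ K X)
    (hXm : ∀ t, Measurable (X t)) (t : ℕ) {φ ψ : Ω → ℝ} (hφ : Integrable φ μ)
    (hψ : Integrable ψ μ)
    (hle : ∀ (ν : Measure Ω) [IsProbabilityMeasure ν] (x : ℕ → S),
      IsMarkovChain ν K (fun s => X (t + s)) → (∀ᵐ ω ∂ν, ∀ s ≤ t, X s ω = x s) →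
      ∫ ω, φ ω ∂ν ≤ ∫ ω, ψ ω ∂ν) :
    ∫ ω, φ ω ∂μ ≤ ∫ ω, ψ ω ∂μ := by
  have := Fintype.ofFinite S
  classical
  let Y : Ω → Fin (t + 1) → S := fun ω i => X i ω
  have hY : Measurable Y := measurable_pi_lambda _ fun i => hXm i
  have hfiber : ∀ q, Y ⁻¹' {q} = {ω | ∀ s ≤ t, X s ω = q (Fin.ofNat (t + 1) s)} := fun q => by
    ext ω
    refine ⟨?_, fun h => funext fun i => by simpa using h i (Nat.le_of_lt_succ i.2)⟩
    rintro rfl s hs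
    simp [Y, Nat.mod_eq_of_lt (Nat.lt_succ_of_le hs)]
  have htotal : ∀ χ : Ω → ℝ, Integrable χ μ →
      ∫ ω, χ ω ∂μ = ∑ q, μ.real (Y ⁻¹' {q}) * ∫ ω, χ ω ∂μ[|Y ⁻¹' {q}] := fun χ hχ => by
    rw [← sum_meas_smul_cond_fiber hY μ, integrable_finsetSum_measure] at hχ
    conv_lhs => rw [← sum_meas_smul_cond_fiber hY μ]
    simp only [integral_finsetSum_measure hχ, integral_smul_measure, smul_eq_mul, measureReal_def]
  rw [htotal φ hφ, htotal ψ hψ]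
  refine Finset.sum_le_sum fun q _ => ?_
  rcases eq_or_ne (μ (Y ⁻¹' {q})) 0 with hq | hq
  · simp only [measureReal_def, hq, ENNReal.toReal_zero, zero_mul, le_refl]
  have := cond_isProbabilityMeasure hq
  rw [hfiber] at this ⊢
  refine mul_le_mul_of_nonneg_left ?_ measureReal_nonneg
  exact hle _ (fun s => q (Fin.ofNat (t + 1) s))
    (hX.cond hXm t _) (ae_cond_mem (measurableSet_path_eq hXm t _))

end Finite

theorem IsMarkovChain.measureReal_le_of_forall_initial [Finite S] [IsProbabilityMeasure μ]
    (hX : IsMarkovChain μ K X) (hXm : ∀ t, Measurable (X t)) {A : Set Ω} (hA : MeasurableSet A)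
    {B : ℝ} (hB : ∀ (ν : Measure Ω) [IsProbabilityMeasure ν] (x : S), IsMarkovChain ν K X →
      (∀ᵐ ω ∂ν, X 0 ω = x) → ν.real A ≤ B) :
    μ.real A ≤ B := by
  rw [← integral_indicator_one hA, show B = ∫ _, B ∂μ by simp]
  refine hX.integral_mono_of_cond hXm 0 ((integrable_const 1).indicator hA) (integrable_const B)
    fun ν _ x hν hx => ?_
  rw [integral_indicator_one hA, integral_const, probReal_univ, one_smul]
  simp only [zero_add] at hν
  exact hB ν (x 0) hν (hx.mono fun ω h => h 0 le_rfl)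

section Fintype

variable [Fintype S]

theorem integral_comp_eq_sum {Y : Ω → S} [IsFiniteMeasure μ] (hY : Measurable Y) (φ : S → ℝ) :
    ∫ ω, φ (Y ω) ∂μ = ∑ y, μ.real {ω | Y ω = y} * φ y := by
  rw [← integral_map hY.aemeasurable (measurable_of_finite φ).aestronglyMeasurable,
    integral_fintype Integrable.of_finite]
  simp only [map_measureReal_apply hY (measurableSet_singleton _), smul_eq_mul]
  rfl

theorem IsMarkovChain.integral_succ [IsProbabilityMeasure μ] (hX : IsMarkovChain μ K X)
    (hXm : ∀ t, Measurable (X t)) (φ : S → ℝ) (t : ℕ) :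
    ∫ ω, φ (X (t + 1) ω) ∂μ = ∫ ω, (Matrix.of K *ᵥ φ) (X t ω) ∂μ := by
  have hcond : ∀ (ν : Measure Ω) [IsProbabilityMeasure ν] (x : ℕ → S),
      IsMarkovChain ν K (fun s => X (t + s)) → (∀ᵐ ω ∂ν, ∀ s ≤ t, X s ω = x s) →
      ∫ ω, φ (X (t + 1) ω) ∂ν = ∫ ω, (Matrix.of K *ᵥ φ) (X t ω) ∂ν := fun ν _ x hν hx => by
    have hxt : ∀ᵐ ω ∂ν, X t ω = x t := hx.mono fun ω h => h t le_rfl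
    rw [integral_comp_eq_sum (hXm _), integral_congr_ae (g := fun _ => (Matrix.of K *ᵥ φ) (x t))
      (hxt.mono fun ω h => by rw [h])]
    simp [hν.measureReal_one_eq hxt, mulVec, dotProduct]
  have hint := integrable_comp (μ := μ) (hXm (t + 1)) φ
  have hint' := integrable_comp (μ := μ) (hXm t) (Matrix.of K *ᵥ φ)
  exact le_antisymm
    (hX.integral_mono_of_cond hXm t hint hint' fun ν _ x hν hx => (hcond ν x hν hx).le)
    (hX.integral_mono_of_cond hXm t hint' hint fun ν _ x hν hx => (hcond ν x hν hx).ge)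

theorem IsMarkovChain.integral_eq_pow_mulVec [DecidableEq S] [IsProbabilityMeasure μ]
    {K : Matrix S S ℝ} (hX : IsMarkovChain μ K X)
    (hXm : ∀ t, Measurable (X t)) {x : S} (hx : ∀ᵐ ω ∂μ, X 0 ω = x) (φ : S → ℝ) (t : ℕ) :
    ∫ ω, φ (X t ω) ∂μ = (K ^ t *ᵥ φ) x := by
  induction t generalizing φ with
  | zero =>
    rw [integral_congr_ae (g := fun _ => φ x) (hx.mono fun ω h => by rw [h])]
    simp
  | succ t ih => rw [hX.integral_succ hXm, pow_succ, ← mulVec_mulVec]; exact ih _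

end Fintype

theorem IsMarkovChain.ae_succ_mem [Finite S] [IsProbabilityMeasure μ] (hX : IsMarkovChain μ K X)
    (hXm : ∀ t, Measurable (X t)) {s : Set S} (hs : ∀ x, ∀ y ∉ s, K x y = 0) (t : ℕ) :
    ∀ᵐ ω ∂μ, X (t + 1) ω ∈ s := by
  have := Fintype.ofFinite S
  classical
  have hzero : Matrix.of K *ᵥ sᶜ.indicator 1 = 0 := funext fun x =>
    Finset.sum_eq_zero fun y _ => by
      by_cases hy : y ∈ s
      · simp [hy]
      · simp [hs x y hy]
  have hnull : μ.real (X (t + 1) ⁻¹' sᶜ) = 0 := by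
    rw [← integral_indicator_one (hXm _ s.toFinite.measurableSet.compl)]
    exact (hX.integral_succ hXm (sᶜ.indicator 1) t).trans (by simp [hzero])
  exact (measureReal_eq_zero_iff).1 hnull

end MarkovChain

section AdditiveFunctionals

variable {S Ω : Type*} {f : S → ℝ} {c : ℝ}

/-- The additive functional `f (X 1) + ⋯ + f (X N)` of a process; `X 0` is not counted. -/
def pathSum (f : S → ℝ) (X : ℕ → Ω → S) (N : ℕ) (ω : Ω) : ℝ :=
  ∑ t ∈ Finset.range N, f (X (t + 1) ω)

theorem pathSum_add (f : S → ℝ) (X : ℕ → Ω → S) (L N : ℕ) (ω : Ω) :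
    pathSum f X (L + N) ω = pathSum f X L ω + pathSum f (fun t => X (L + t)) N ω :=
  Finset.sum_range_add _ _ _

theorem pathSum_eq_sum_Icc (f : S → ℝ) (X : ℕ → Ω → S) (N : ℕ) (ω : Ω) :
    pathSum f X N ω = ∑ t ∈ Finset.Icc 1 N, f (X t ω) := by
  rw [pathSum, Finset.range_eq_Ico, Finset.sum_Ico_add' (fun t => f (X t ω)) 0 N 1]
  rfl

theorem oscLE_pathSum (hf : OscLE f c) (X : ℕ → Ω → S) (N : ℕ) :
    OscLE (pathSum f X N) (N * c) := by
  simpa only [OscLE, pathSum, Finset.card_range] using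
    OscLE.sum (Finset.range N) fun t => hf.comp (X (t + 1))

theorem measurable_pathSum [Finite S] [MeasurableSpace S] [MeasurableSingletonClass S]
    [MeasurableSpace Ω] {X : ℕ → Ω → S} (hXm : ∀ t, Measurable (X t)) (f : S → ℝ) (N : ℕ) :
    Measurable (pathSum f X N) :=
  Finset.measurable_sum _ fun t _ => (measurable_of_finite f).comp (hXm (t + 1))

variable [Fintype S] {K : Matrix S S ℝ}

theorem dotProduct_congr_of_stationary {π : S → ℝ} (hst : π ᵥ* K = π) {s : Set S}
    (hs : ∀ x, ∀ y ∉ s, K x y = 0) {f f' : S → ℝ} (hff' : Set.EqOn f' f s) :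
    π ⬝ᵥ f' = π ⬝ᵥ f := by
  have hπs : ∀ y ∉ s, π y = 0 := fun y hy => by
    rw [← hst]
    exact Finset.sum_eq_zero fun x _ => mul_eq_zero_of_right _ (hs x y hy)
  refine Finset.sum_congr rfl fun y _ => ?_
  by_cases hy : y ∈ s
  · rw [hff' hy]
  · rw [hπs y hy, zero_mul, zero_mul]

variable [DecidableEq S]

/-- The expectation of `pathSum f X N` for a Markov chain `X` with kernel `K`, as a function of
the initial state. -/
def expectedSum (K : Matrix S S ℝ) (f : S → ℝ) (N : ℕ) : S → ℝ :=
  ∑ t ∈ Finset.range N, K ^ (t + 1) *ᵥ f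

theorem expectedSum_add (K : Matrix S S ℝ) (f : S → ℝ) (L N : ℕ) :
    expectedSum K f (L + N) = expectedSum K f L + K ^ L *ᵥ expectedSum K f N := by
  simp only [expectedSum, Finset.sum_range_add, mulVec_sum, mulVec_mulVec, ← pow_add, add_assoc]

theorem dotProduct_pow_mulVec {π : S → ℝ} (hst : π ᵥ* K = π) (h : S → ℝ) (t : ℕ) :
    π ⬝ᵥ (K ^ t *ᵥ h) = π ⬝ᵥ h := by
  induction t with
  | zero => simp
  | succ t ih => rw [pow_succ', ← mulVec_mulVec, dotProduct_mulVec, hst, ih]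

theorem dotProduct_expectedSum {π : S → ℝ} (hst : π ᵥ* K = π) (f : S → ℝ) (N : ℕ) :
    π ⬝ᵥ expectedSum K f N = N * (π ⬝ᵥ f) := by
  simp [expectedSum, dotProduct_sum, dotProduct_pow_mulVec hst]

theorem oscLE_expectedSum (hK : K ∈ rowStochastic ℝ S) (hf : OscLE f c) (N : ℕ) :
    OscLE (expectedSum K f N) (N * c) := by
  simpa only [OscLE, expectedSum, Finset.sum_apply, Finset.card_range] using
    OscLE.sum (Finset.range N) fun t => hf.mulVec (pow_mem hK (t + 1))

theorem abs_expectedSum_sub_le {π : S → ℝ} (hπ : π ∈ stdSimplex ℝ S) (hst : π ᵥ* K = π) {N : ℕ}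
    {o : ℝ} (ho : OscLE (expectedSum K f N) o) (x : S) :
    |expectedSum K f N x - N * (π ⬝ᵥ f)| ≤ o := by
  have hx : Pi.single x 1 ∈ stdSimplex ℝ S := single_mem_stdSimplex ℝ x
  rw [← dotProduct_expectedSum hst, ← single_one_dotProduct x (expectedSum K f N), abs_sub_le_iff]
  exact ⟨ho.dotProduct_sub_le hx hπ, ho.dotProduct_sub_le hπ hx⟩

variable [MeasurableSpace S] [MeasurableSpace Ω]

variable (Ω) in
/-- Given any initial state, the additive functional `pathSum f X N` of a Markov chain on `Ω` with
kernel `K` is subgaussian around its mean, with variance proxy `V / 4`. -/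
def HasSubgaussianSums (K : Matrix S S ℝ) (f : S → ℝ) (N : ℕ) (V : ℝ) : Prop :=
  ∀ (μ : Measure Ω) [IsProbabilityMeasure μ] (X : ℕ → Ω → S) (x : S),
    (∀ t, Measurable (X t)) → IsMarkovChain μ K X → (∀ᵐ ω ∂μ, X 0 ω = x) →
    ∀ l, mgf (pathSum f X N) μ l ≤ Real.exp (l * expectedSum K f N x + l ^ 2 * V / 8)

theorem hasSubgaussianSums_zero : HasSubgaussianSums Ω K f 0 0 := by
  intro μ _ X x _ _ _ l
  simp [mgf, pathSum, expectedSum]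

variable [MeasurableSingletonClass S]

theorem IsMarkovChain.integral_pathSum {μ : Measure Ω} [IsProbabilityMeasure μ] {X : ℕ → Ω → S}
    (hX : IsMarkovChain μ K X) (hXm : ∀ t, Measurable (X t)) {x : S}
    (hx : ∀ᵐ ω ∂μ, X 0 ω = x) (f : S → ℝ) (N : ℕ) :
    ∫ ω, pathSum f X N ω ∂μ = expectedSum K f N x := by
  simp only [pathSum, expectedSum, Finset.sum_apply,
    integral_finsetSum _ fun t _ => integrable_comp (hXm (t + 1)) f,
    hX.integral_eq_pow_mulVec hXm hx]

/-- Given the past up to time `L`, the remaining sum is integrated out at the cost `V` and replaced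
by its conditional mean, a function of `X L`. -/
theorem HasSubgaussianSums.mgf_add_le {N : ℕ} {V : ℝ} (hV : HasSubgaussianSums Ω K f N V)
    {μ : Measure Ω} [IsProbabilityMeasure μ] {X : ℕ → Ω → S} (hX : IsMarkovChain μ K X)
    (hXm : ∀ t, Measurable (X t)) {c o : ℝ} (hf : OscLE f c) (ho : OscLE (expectedSum K f N) o)
    (L : ℕ) (l : ℝ) :
    mgf (pathSum f X (L + N)) μ l ≤ Real.exp (l ^ 2 * V / 8) *
      mgf (pathSum f X L + fun ω => expectedSum K f N (X L ω)) μ l := by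
  let Z : Ω → ℝ := pathSum f X L + fun ω => expectedSum K f N (X L ω)
  have hZ : Integrable (fun ω => Real.exp (l * Z ω)) μ :=
    ((oscLE_pathSum hf X L).add (ho.comp (X L))).integrable_exp_mul
      ((measurable_pathSum hXm f L).add ((measurable_of_finite _).comp (hXm L))) l
  refine (hX.integral_mono_of_cond hXm L
    ((oscLE_pathSum hf X _).integrable_exp_mul (measurable_pathSum hXm f _) l)
    (hZ.const_mul _) fun ν _ y hν hy => ?_).trans_eq (integral_const_mul _ _)
  let a := ∑ t ∈ Finset.range L, f (y (t + 1))
  have ha : ∀ᵐ ω ∂ν, pathSum f X L ω = a := hy.mono fun ω h =>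
    Finset.sum_congr rfl fun t ht => by rw [h (t + 1) (Finset.mem_range.1 ht)]
  have hyL : ∀ᵐ ω ∂ν, X L ω = y L := hy.mono fun ω h => h L le_rfl
  calc ∫ ω, Real.exp (l * pathSum f X (L + N) ω) ∂ν
      = ∫ ω, Real.exp (l * a) * Real.exp (l * pathSum f (fun t => X (L + t)) N ω) ∂ν :=
        integral_congr_ae <| ha.mono fun ω h => by
          simp only [pathSum_add, h, mul_add, Real.exp_add]
    _ = Real.exp (l * a) * mgf (pathSum f (fun t => X (L + t)) N) ν l := integral_const_mul _ _
    _ ≤ Real.exp (l * a) * Real.exp (l * expectedSum K f N (y L) + l ^ 2 * V / 8) := by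
        gcongr
        exact hV ν _ (y L) (fun t => hXm (L + t)) hν hyL l
    _ = ∫ _, Real.exp (l ^ 2 * V / 8) * Real.exp (l * (a + expectedSum K f N (y L))) ∂ν := by
        simp only [integral_const, probReal_univ, one_smul, ← Real.exp_add]
        ring_nf
    _ = ∫ ω, Real.exp (l ^ 2 * V / 8) * Real.exp (l * Z ω) ∂ν := by
        refine integral_congr_ae ?_
        filter_upwards [ha, hyL] with ω h h'
        simp only [Z, Pi.add_apply, h, h']

theorem HasSubgaussianSums.add {N : ℕ} {V o : ℝ} (hV : HasSubgaussianSums Ω K f N V)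
    (hf : OscLE f c) (ho : OscLE (expectedSum K f N) o) (L : ℕ) :
    HasSubgaussianSums Ω K f (L + N) (V + (L * c + o) ^ 2) := by
  intro μ _ X x hXm hX hx l
  have hpast := measurable_pathSum hXm f L
  have hfuture : Measurable fun ω => expectedSum K f N (X L ω) :=
    (measurable_of_finite _).comp (hXm L)
  have hmean : ∫ ω, (pathSum f X L + fun ω => expectedSum K f N (X L ω)) ω ∂μ =
      expectedSum K f (L + N) x := by
    rw [expectedSum_add, Pi.add_apply, ← hX.integral_pathSum hXm hx,
      ← hX.integral_eq_pow_mulVec hXm hx]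
    exact integral_add ((oscLE_pathSum hf X L).integrable hpast)
      ((ho.comp (X L)).integrable hfuture)
  calc mgf (pathSum f X (L + N)) μ l
      ≤ Real.exp (l ^ 2 * V / 8) *
          mgf (pathSum f X L + fun ω => expectedSum K f N (X L ω)) μ l :=
        hV.mgf_add_le hX hXm hf ho L l
    _ ≤ Real.exp (l ^ 2 * V / 8) *
          Real.exp (l * expectedSum K f (L + N) x + l ^ 2 * (L * c + o) ^ 2 / 8) := by
        gcongr
        exact hmean ▸ ((oscLE_pathSum hf X L).add (ho.comp (X L))).mgf_le (hpast.add hfuture) l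
    _ = Real.exp (l * expectedSum K f (L + N) x + l ^ 2 * (V + (L * c + o) ^ 2) / 8) := by
        rw [← Real.exp_add]
        ring_nf

/-- The recursion adds blocks of length `τ`: the mean of the sum over the future has oscillation `o`
obeying `o ↦ τ * c + o / 2`, whose fixed point is `2 * τ * c`, so a block has oscillation below
`3 * τ * c` and increases `V` by less than `9 * τ * (τ * c ^ 2)`. The term `8 * τ * c * o` makes the
bound inductive while covering the cost `4 * o ^ 2` of the bias. -/
theorem exists_hasSubgaussianSums (hK : K ∈ rowStochastic ℝ S) (hf : OscLE f c) (hc : 0 < c)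
    {τ : ℕ} (hτ : 0 < τ) (hmix : HalvesOsc (K ^ τ)) {N : ℕ} (hN : 0 < N) :
    ∃ o V : ℝ, 0 < o ∧ o < 2 * τ * c ∧ V + 8 * τ * c * o ≤ 9 * N * τ * c ^ 2 ∧
      OscLE (expectedSum K f N) o ∧ HasSubgaussianSums Ω K f N V := by
  have hτ' : (0 : ℝ) < τ := Nat.cast_pos.2 hτ
  induction N using Nat.strong_induction_on with
  | _ N ih =>
    rcases le_or_gt N τ with hNτ | hNτ
    · have hNτ' : (N : ℝ) ≤ τ := Nat.cast_le.2 hNτ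
      have hV := (hasSubgaussianSums_zero (Ω := Ω) (K := K) (f := f)).add hf (o := 0)
        (by simpa using oscLE_expectedSum hK hf 0) N
      refine ⟨N * c, _, by positivity, by nlinarith, ?_, oscLE_expectedSum hK hf N, hV⟩
      nlinarith [mul_le_mul_of_nonneg_left hNτ' (by positivity : 0 ≤ N * c ^ 2)]
    · obtain ⟨M, rfl⟩ := Nat.exists_eq_add_of_lt hNτ
      obtain ⟨o, V, ho, hoτ, hVo, hosc, hV⟩ := ih (M + 1) (by omega) M.succ_pos
      have hosc' : OscLE (expectedSum K f (τ + (M + 1))) (τ * c + o / 2) := by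
        rw [expectedSum_add]
        exact (oscLE_expectedSum hK hf τ).add (hmix hosc)
      refine ⟨τ * c + o / 2, _, by positivity, by linarith, ?_, hosc', hV.add hf hosc τ⟩
      push_cast at hVo ⊢
      nlinarith

theorem IsMarkovChain.measureReal_pathSum_deviation_lt {μ : Measure Ω} [IsProbabilityMeasure μ]
    {X : ℕ → Ω → S} (hX : IsMarkovChain μ K X) (hXm : ∀ t, Measurable (X t))
    (hK : K ∈ rowStochastic ℝ S) {π : S → ℝ} (hπ : π ∈ stdSimplex ℝ S) (hst : π ᵥ* K = π)
    (hf : OscLE f c) (hc : 0 < c) {τ : ℕ} (hτ : 0 < τ) (hmix : HalvesOsc (K ^ τ))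
    {N : ℕ} (hN : 0 < N) {d : ℝ} (hd : 0 < d) :
    μ.real {ω | d ≤ |pathSum f X N ω - N * (π ⬝ᵥ f)|} <
      2 * Real.exp (-(2 * d ^ 2) / (9 * N * τ * c ^ 2)) := by
  obtain ⟨o, V, ho, hoτ, hVo, hosc, hV⟩ := exists_hasSubgaussianSums (Ω := Ω) hK hf hc hτ hmix hN
  set W : ℝ := 9 * N * τ * c ^ 2
  have hW : V + 4 * o ^ 2 < W := by nlinarith
  have hW0 : 0 < W := by positivity
  let l : ℝ := 4 * d / W
  have hl : 0 < l := by positivity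
  have hZm := measurable_pathSum hXm f N
  calc μ.real {ω | d ≤ |pathSum f X N ω - N * (π ⬝ᵥ f)|}
      ≤ 2 * Real.exp (-l * d + l ^ 2 * (V + 4 * o ^ 2) / 8) :=
        hX.measureReal_le_of_forall_initial hXm
          (measurableSet_le measurable_const (hZm.sub_const _).abs) fun ν _ x hν hx =>
          measureReal_le_abs_sub_le ((oscLE_pathSum hf X N).integrable_exp_mul hZm)
            (hV ν X x hXm hν hx) (abs_expectedSum_sub_le hπ hst hosc x) d hl.le
    _ < 2 * Real.exp (-l * d + l ^ 2 * W / 8) := by gcongr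
    _ = 2 * Real.exp (-(2 * d ^ 2) / W) := by
        congr 2
        simp only [l]
        field_simp
        ring

/-- States off `s` are not seen by `π`, nor by the chain after time `0`, so `f` may be replaced
there by one of its values on `s`. -/
theorem IsMarkovChain.measureReal_average_deviation_lt {μ : Measure Ω} [IsProbabilityMeasure μ]
    {X : ℕ → Ω → S} (hX : IsMarkovChain μ K X) (hXm : ∀ t, Measurable (X t))
    (hK : K ∈ rowStochastic ℝ S) {π : S → ℝ} (hπ : π ∈ stdSimplex ℝ S) (hst : π ᵥ* K = π)
    {s : Set S} (hs : ∀ x, ∀ y ∉ s, K x y = 0) (hf : ∀ x ∈ s, ∀ y ∈ s, f x - f y ≤ c)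
    (hc : 0 < c) {τ : ℕ} (hτ : 0 < τ) (hmix : HalvesOsc (K ^ τ)) {N : ℕ} (hN : 0 < N)
    {δ : ℝ} (hδ : 0 < δ) :
    μ.real {ω | δ ≤ |π ⬝ᵥ f - 1 / (N : ℝ) * ∑ t ∈ Finset.Icc 1 N, f (X t ω)|} <
      2 * Real.exp (-(2 * δ ^ 2 * N) / (9 * c ^ 2 * τ)) := by
  have hN' : (0 : ℝ) < N := Nat.cast_pos.2 hN
  have hXs : ∀ᵐ ω ∂μ, ∀ t, X (t + 1) ω ∈ s := ae_all_iff.2 (hX.ae_succ_mem hXm hs)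
  obtain ⟨ω₀, hω₀⟩ := hXs.exists
  obtain ⟨f', hf', hff'⟩ := exists_oscLE_eqOn ⟨_, hω₀ 0⟩ hf
  calc μ.real {ω | δ ≤ |π ⬝ᵥ f - 1 / (N : ℝ) * ∑ t ∈ Finset.Icc 1 N, f (X t ω)|}
      = μ.real {ω | δ * N ≤ |pathSum f' X N ω - N * (π ⬝ᵥ f')|} := by
        refine measureReal_congr (Filter.eventuallyEq_set.2 (hXs.mono fun ω hω => ?_))
        have hsum : pathSum f' X N ω = pathSum f X N ω :=
          Finset.sum_congr rfl fun t _ => hff' (hω t)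
        have hscale : |π ⬝ᵥ f - 1 / (N : ℝ) * pathSum f X N ω| =
            |pathSum f X N ω - N * (π ⬝ᵥ f)| / N := by
          rw [abs_sub_comm, ← abs_of_pos hN', ← abs_div, abs_of_pos hN']
          congr 1
          field_simp
        simp only [Set.mem_ofPred_eq, hsum, dotProduct_congr_of_stationary hst hs hff',
          ← pathSum_eq_sum_Icc, hscale, le_div_iff₀ hN']
    _ < 2 * Real.exp (-(2 * (δ * N) ^ 2) / (9 * N * τ * c ^ 2)) :=
        hX.measureReal_pathSum_deviation_lt hXm hK hπ hst hf' hc hτ hmix hN (by positivity)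
    _ = 2 * Real.exp (-(2 * δ ^ 2 * N) / (9 * c ^ 2 * τ)) := by
        congr 2
        field_simp

end AdditiveFunctionals

theorem exists_mixingTime_eq {R : Type*} [Fintype R] [DecidableEq R] {P : Matrix R R ℝ}
    {π : R → ℝ} {ε : ℝ} (h : mixingTime P π ε ≠ ⊤) :
    ∃ t : ℕ, mixingTime P π ε = t ∧ ∀ x, tvDist ((P ^ t) x) π ≤ ε := by
  rw [mixingTime, ← sInf_image] at h ⊢
  have hne : ((fun t : ℕ => (t : ℕ∞)) '' {t | ∀ x, tvDist ((P ^ t) x) π ≤ ε}).Nonempty :=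
    Set.nonempty_iff_ne_empty.2 fun h0 => h (by rw [h0, sInf_empty])
  obtain ⟨t, ht, hte⟩ := csInf_mem hne
  exact ⟨t, hte.symm, ht⟩

section LiftedChains

variable {R S : Type*} [Fintype S] [DecidableEq R] {ρ : S → R} {π : S → ℝ}

/-- The marginal of `π` under `ρ`. -/
def fiberMass (ρ : S → R) (π : S → ℝ) (a : R) : ℝ :=
  ∑ x with ρ x = a, π x

/-- The kernel from `R` to `S` whose row at `a` is the distribution `π` conditioned on the fiber of
`ρ` over `a`. -/
noncomputable def fiberKernel (ρ : S → R) (π : S → ℝ) : Matrix R S ℝ :=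
  of fun a y => if ρ y = a then π y / fiberMass ρ π a else 0

/-- The lift of a kernel `P` on `R` to `S`: the value of `ρ` moves according to `P`, and then the
new state is drawn from `π` conditioned on this value. -/
noncomputable def liftKernel (P : Matrix R R ℝ) (ρ : S → R) (π : S → ℝ) : Matrix S S ℝ :=
  of fun x y => P (ρ x) (ρ y) * (π y / fiberMass ρ π (ρ y))

theorem sum_fiberMass_mul [Fintype R] (ρ : S → R) (π : S → ℝ) (v : R → ℝ) :
    ∑ a, fiberMass ρ π a * v a = ∑ x, π x * v (ρ x) := by
  rw [← Finset.sum_fiberwise Finset.univ ρ]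
  refine Finset.sum_congr rfl fun a _ => ?_
  rw [fiberMass, Finset.sum_mul]
  exact Finset.sum_congr rfl fun x hx => by rw [(Finset.mem_filter.1 hx).2]

theorem fiberKernel_mem_stdSimplex (hπ : ∀ x, 0 ≤ π x) {a : R} (ha : fiberMass ρ π a ≠ 0) :
    fiberKernel ρ π a ∈ stdSimplex ℝ S := by
  refine ⟨fun y => ?_, ?_⟩
  · simp only [fiberKernel, of_apply]
    split_ifs
    exacts [div_nonneg (hπ y) (Finset.sum_nonneg fun x _ => hπ x), le_rfl]
  · simp only [fiberKernel, of_apply, ← Finset.sum_filter, ← Finset.sum_div]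
    exact div_self ha

theorem fiberKernel_mul_submatrix {T : Type*} (hρ : ∀ a, fiberMass ρ π a ≠ 0)
    (M : Matrix R T ℝ) : fiberKernel ρ π * M.submatrix ρ id = M := by
  ext a t
  simp only [fiberKernel, mul_apply, of_apply, submatrix_apply, id, ite_mul, zero_mul,
    ← Finset.sum_filter]
  rw [Finset.sum_congr rfl fun y hy => by rw [(Finset.mem_filter.1 hy).2], ← Finset.sum_mul,
    ← Finset.sum_div]
  exact (congrArg (· * M a t) (div_self (hρ a))).trans (one_mul _)

variable [Fintype R] {P : Matrix R R ℝ}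

theorem liftKernel_eq_submatrix (P : Matrix R R ℝ) (ρ : S → R) (π : S → ℝ) :
    liftKernel P ρ π = (P * fiberKernel ρ π).submatrix ρ id := by
  ext x y
  simp [liftKernel, fiberKernel, mul_apply]

theorem liftKernel_mem_rowStochastic [DecidableEq S] (hP : P ∈ rowStochastic ℝ R)
    (hπ : ∀ x, 0 ≤ π x) (hρ : ∀ a, fiberMass ρ π a ≠ 0) :
    liftKernel P ρ π ∈ rowStochastic ℝ S := by
  refine mem_rowStochastic.2 ⟨fun x y => mul_nonneg (nonneg_of_mem_rowStochastic hP)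
    (div_nonneg (hπ y) (Finset.sum_nonneg fun x _ => hπ x)), funext fun x => ?_⟩
  have hfiber : fiberKernel ρ π *ᵥ 1 = 1 := funext fun a =>
    (dotProduct_one _).trans (fiberKernel_mem_stdSimplex hπ (hρ a)).2
  calc (liftKernel P ρ π *ᵥ 1) x = (P *ᵥ (fiberKernel ρ π *ᵥ 1)) (ρ x) := by
        rw [liftKernel_eq_submatrix, mulVec_mulVec]
        rfl
    _ = 1 := by rw [hfiber, one_vecMul_of_mem_rowStochastic hP]; rfl

theorem vecMul_liftKernel (hρ : ∀ a, fiberMass ρ π a ≠ 0)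
    (hst : fiberMass ρ π ᵥ* P = fiberMass ρ π) : π ᵥ* liftKernel P ρ π = π := by
  ext y
  calc (π ᵥ* liftKernel P ρ π) y
      = (∑ x, π x * P (ρ x) (ρ y)) * (π y / fiberMass ρ π (ρ y)) := by
        simp only [vecMul, dotProduct, liftKernel, of_apply, Finset.sum_mul, mul_assoc]
    _ = fiberMass ρ π (ρ y) * (π y / fiberMass ρ π (ρ y)) := by
        rw [← sum_fiberMass_mul ρ π fun a => P a (ρ y)]
        exact congrArg (· * _) (congrFun hst (ρ y))
    _ = π y := mul_div_cancel₀ _ (hρ _)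

theorem liftKernel_pow_succ [DecidableEq S] (P : Matrix R R ℝ) (hρ : ∀ a, fiberMass ρ π a ≠ 0)
    (t : ℕ) :
    liftKernel P ρ π ^ (t + 1) = (P ^ (t + 1) * fiberKernel ρ π).submatrix ρ id := by
  induction t with
  | zero => simp only [zero_add, pow_one, liftKernel_eq_submatrix]
  | succ t ih =>
    calc liftKernel P ρ π ^ (t + 1 + 1)
        = (P * (fiberKernel ρ π * (P ^ (t + 1) * fiberKernel ρ π).submatrix ρ id)).submatrix
            ρ id := by
          rw [pow_succ', ih, liftKernel_eq_submatrix, ← Matrix.mul_assoc]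
          rfl
      _ = (P ^ (t + 1 + 1) * fiberKernel ρ π).submatrix ρ id := by
          rw [fiberKernel_mul_submatrix hρ, ← Matrix.mul_assoc, ← pow_succ']

theorem HalvesOsc.liftKernel_pow [DecidableEq S] (hπ : ∀ x, 0 ≤ π x)
    (hρ : ∀ a, fiberMass ρ π a ≠ 0) {t : ℕ} (ht : 0 < t) (hP : HalvesOsc (P ^ t)) :
    HalvesOsc (liftKernel P ρ π ^ t) := by
  obtain ⟨t, rfl⟩ := Nat.exists_eq_add_of_lt ht
  intro h o hh
  have hfiber : OscLE (fiberKernel ρ π *ᵥ h) o := fun a b =>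
    hh.dotProduct_sub_le (fiberKernel_mem_stdSimplex hπ (hρ a))
      (fiberKernel_mem_stdSimplex hπ (hρ b))
  rw [zero_add] at hP ⊢
  rw [liftKernel_pow_succ P hρ]
  have hlift := (hP hfiber).comp ρ
  rwa [mulVec_mulVec] at hlift

theorem IsMarkovChain.measureReal_average_deviation_lt_of_lift {Ω : Type*} [MeasurableSpace Ω]
    [MeasurableSpace S] [MeasurableSingletonClass S] {μ : Measure Ω} [IsProbabilityMeasure μ]
    {X : ℕ → Ω → S} (hX : IsMarkovChain μ (liftKernel P ρ π) X) (hXm : ∀ t, Measurable (X t))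
    (hP : P ∈ rowStochastic ℝ R) (hπ : π ∈ stdSimplex ℝ S) (hρ : ∀ a, fiberMass ρ π a ≠ 0)
    (hst : fiberMass ρ π ᵥ* P = fiberMass ρ π) {f : S → ℝ} {c : ℝ} (hc : 0 < c)
    (hf : ∀ x, 0 < π x → ∀ y, 0 < π y → f x - f y ≤ c) {N : ℕ} (hN : 0 < N) {δ : ℝ}
    (hδ : 0 < δ) :
    μ.real {ω | δ ≤ |π ⬝ᵥ f - 1 / (N : ℝ) * ∑ t ∈ Finset.Icc 1 N, f (X t ω)|} <
      2 * Real.exp (-(2 * δ ^ 2 * N) / (9 * c ^ 2) *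
        ((mixingTime P (fiberMass ρ π) (1 / 4) : ENNReal)⁻¹).toReal) := by
  classical
  have htrivial : ∀ A : Set Ω, μ.real A < 2 * Real.exp 0 := fun A => by
    rw [Real.exp_zero]
    linarith [measureReal_le_one (μ := μ) (s := A)]
  by_cases htop : mixingTime P (fiberMass ρ π) (1 / 4) = ⊤
  · rw [htop]
    simpa using htrivial _
  obtain ⟨τ, hτe, hτmix⟩ := exists_mixingTime_eq htop
  rw [hτe]
  rcases τ.eq_zero_or_pos with rfl | hτ
  · simpa using htrivial _
  have hmix := (halvesOsc_of_tvDist_le (pow_mem hP τ) hτmix).liftKernel_pow hπ.1 hρ hτ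
  have hsupport : ∀ x, ∀ y ∉ {y | 0 < π y}, liftKernel P ρ π x y = 0 := fun x y hy => by
    simp [liftKernel, (hπ.1 y).antisymm' (not_lt.1 hy)]
  refine (hX.measureReal_average_deviation_lt hXm (liftKernel_mem_rowStochastic hP hπ.1 hρ) hπ
    (vecMul_liftKernel hρ hst) hsupport hf hc hτ hmix hN hδ).trans_eq ?_
  rw [ENat.toENNReal_coe, ENNReal.toReal_inv, ENNReal.toReal_natCast]
  congr 2
  field_simp

end LiftedChains

section Metropolis

variable {R : Type*} [Fintype R] [DecidableEq R] {Ψ : Matrix R R ℝ} {π : R → ℝ}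

/-- The probability with which the Metropolis-Hastings chain with proposal kernel `Ψ` and target
`π` accepts a move. Moves from `a` to `b` with `Ψ a b = 0` get the junk value `0`, which is
harmless as they are never proposed. -/
noncomputable def metropolisAccept (Ψ : Matrix R R ℝ) (π : R → ℝ) (a b : R) : ℝ :=
  min (π b * Ψ b a / (π a * Ψ a b)) 1

/-- The transition kernel of the Metropolis-Hastings chain with proposal kernel `Ψ` and
target `π`. -/
noncomputable def metropolisKernel (Ψ : Matrix R R ℝ) (π : R → ℝ) : Matrix R R ℝ :=
  of fun a b => if b = a then 1 - ∑ c with c ≠ a, Ψ a c * metropolisAccept Ψ π a c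
    else Ψ a b * metropolisAccept Ψ π a b

theorem vecMul_eq_of_detailedBalance {K : Matrix R R ℝ} (hK : K ∈ rowStochastic ℝ R)
    (h : ∀ a b, π a * K a b = π b * K b a) : π ᵥ* K = π := by
  ext b
  simp only [vecMul, dotProduct, h _ b, ← Finset.mul_sum, sum_row_of_mem_rowStochastic hK, mul_one]

theorem metropolisKernel_mem_rowStochastic (hΨ : Ψ ∈ rowStochastic ℝ R) (hπ : ∀ a, 0 ≤ π a) :
    metropolisKernel Ψ π ∈ rowStochastic ℝ R := by
  have hΨ0 : ∀ a b, 0 ≤ Ψ a b := fun _ _ => nonneg_of_mem_rowStochastic hΨ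
  refine mem_rowStochastic_iff_sum.2 ⟨fun a b => ?_, fun a => ?_⟩
  · simp only [metropolisKernel, of_apply]
    split_ifs
    · rw [sub_nonneg, ← sum_row_of_mem_rowStochastic hΨ a]
      calc ∑ c with c ≠ a, Ψ a c * metropolisAccept Ψ π a c ≤ ∑ c with c ≠ a, Ψ a c :=
            Finset.sum_le_sum fun c _ => mul_le_of_le_one_right (hΨ0 a c) (min_le_right _ _)
        _ ≤ ∑ c, Ψ a c :=
            Finset.sum_le_sum_of_subset_of_nonneg (Finset.filter_subset _ _) fun c _ _ => hΨ0 a c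
    · exact mul_nonneg (hΨ0 a b) (le_min (div_nonneg (mul_nonneg (hπ b) (hΨ0 b a))
        (mul_nonneg (hπ a) (hΨ0 a b))) zero_le_one)
  · have hoff : ∑ b with b ≠ a, metropolisKernel Ψ π a b =
        ∑ b with b ≠ a, Ψ a b * metropolisAccept Ψ π a b :=
      Finset.sum_congr rfl fun b hb => if_neg (Finset.mem_filter.1 hb).2
    rw [← Finset.sum_filter_add_sum_filter_not Finset.univ (fun b => b = a), hoff,
      Finset.filter_eq' Finset.univ a, if_pos (Finset.mem_univ a), Finset.sum_singleton]
    exact (congrArg (· + _) (if_pos rfl)).trans (sub_add_cancel _ _)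

theorem metropolisKernel_detailedBalance (hΨ : ∀ a b, 0 ≤ Ψ a b)
    (hsymm : ∀ a b, Ψ a b = 0 → Ψ b a = 0) (hπ : ∀ a, 0 < π a) (a b : R) :
    π a * metropolisKernel Ψ π a b = π b * metropolisKernel Ψ π b a := by
  by_cases hab : b = a
  · rw [hab]
  have hflow : ∀ a b, π a * (Ψ a b * metropolisAccept Ψ π a b) =
      min (π b * Ψ b a) (π a * Ψ a b) := fun a b => by
    rcases (hΨ a b).eq_or_lt with h | h
    · simp [← h, hsymm a b h.symm]
    · have hpos := mul_pos (hπ a) h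
      rw [← mul_assoc, metropolisAccept, mul_min_of_nonneg _ _ hpos.le,
        mul_div_cancel₀ _ hpos.ne', mul_one]
  simp only [metropolisKernel, of_apply, if_neg hab, if_neg (Ne.symm hab), hflow]
  exact min_comm _ _

theorem vecMul_metropolisKernel (hΨ : Ψ ∈ rowStochastic ℝ R)
    (hsymm : ∀ a b, Ψ a b = 0 → Ψ b a = 0) (hπ : ∀ a, 0 < π a) :
    π ᵥ* metropolisKernel Ψ π = π :=
  vecMul_eq_of_detailedBalance (metropolisKernel_mem_rowStochastic hΨ fun a => (hπ a).le)
    (metropolisKernel_detailedBalance (fun _ _ => nonneg_of_mem_rowStochastic hΨ) hsymm hπ)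

end Metropolis

section Pivot

variable {k n : ℕ}

theorem homWeight_nonneg (F : Motif k) (G : Network n) (x : Fin k → Fin n) :
    0 ≤ homWeight F G x :=
  mul_nonneg (Finset.prod_nonneg fun _ _ => Finset.prod_nonneg fun _ _ =>
    Real.rpow_nonneg (G.A_nonneg _ _) _) (Finset.prod_nonneg fun i _ => (G.α_pos (x i)).le)

theorem homDist_nonneg (F : Motif k) (G : Network n) (x : Fin k → Fin n) : 0 ≤ homDist F G x :=
  div_nonneg (homWeight_nonneg F G x) (Finset.sum_nonneg fun y _ => homWeight_nonneg F G y)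

theorem homDist_mem_stdSimplex {F : Motif k} {G : Network n} {x : Fin k → Fin n}
    (hx : IsHom F G x) : homDist F G ∈ stdSimplex ℝ (Fin k → Fin n) := by
  refine ⟨homDist_nonneg F G, ?_⟩
  simp only [homDist, ← Finset.sum_div]
  exact div_self (div_ne_zero_iff.1 hx.ne').2

theorem isHom_of_homWeight_pos {F : Motif k} {G : Network n} {x : Fin k → Fin n}
    (hx : 0 < homWeight F G x) : IsHom F G x :=
  div_pos hx (Finset.sum_pos' (fun y _ => homWeight_nonneg F G y) ⟨x, Finset.mem_univ x, hx⟩)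

section Walk

variable {G : Network n}

/-- The weight of the edge between `a` and `b` in the symmetrized network: `walkKernel G` is the
random walk on this weighted graph. -/
def walkWeight (G : Network n) (a b : Fin n) : ℝ :=
  G.α a * max (G.A a b) (G.A b a) * G.α b

theorem walkWeight_comm (G : Network n) (a b : Fin n) : walkWeight G a b = walkWeight G b a := by
  rw [walkWeight, walkWeight, max_comm, mul_right_comm, mul_comm (G.α a), mul_right_comm]

theorem walkWeight_nonneg (G : Network n) (a b : Fin n) : 0 ≤ walkWeight G a b :=
  mul_nonneg (mul_nonneg (G.α_pos a).le (le_max_of_le_left (G.A_nonneg a b))) (G.α_pos b).le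

theorem sum_walkWeight_pos (hadj : ∀ a, ∃ b, 0 < max (G.A a b) (G.A b a)) (a : Fin n) :
    0 < ∑ b, walkWeight G a b := by
  obtain ⟨b, hb⟩ := hadj a
  exact Finset.sum_pos' (fun c _ => walkWeight_nonneg G a c)
    ⟨b, Finset.mem_univ b, mul_pos (mul_pos (G.α_pos a) hb) (G.α_pos b)⟩

theorem walkKernel_mem_rowStochastic (hadj : ∀ a, ∃ b, 0 < max (G.A a b) (G.A b a)) :
    walkKernel G ∈ rowStochastic ℝ (Fin n) := by
  refine mem_rowStochastic_iff_sum.2 ⟨fun a b => div_nonneg (walkWeight_nonneg G a b)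
    (Finset.sum_nonneg fun c _ => walkWeight_nonneg G a c), fun a => ?_⟩
  simp only [walkKernel, ← Finset.sum_div]
  exact div_self (sum_walkWeight_pos hadj a).ne'

theorem walkKernel_eq_zero_comm (hadj : ∀ a, ∃ b, 0 < max (G.A a b) (G.A b a)) {a b : Fin n} :
    walkKernel G a b = 0 ↔ walkKernel G b a = 0 := by
  have hzero : ∀ a b, walkKernel G a b = 0 ↔ walkWeight G a b = 0 := fun a b =>
    div_eq_zero_iff.trans (or_iff_left (sum_walkWeight_pos hadj a).ne')
  rw [hzero, hzero, walkWeight_comm]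

end Walk

section Root

variable [NeZero k] {F : Motif k} {G : Network n}

theorem chainKernel_eq_liftKernel (F : Motif k) (G : Network n) :
    chainKernel F G = liftKernel (rootKernel F G) (fun x => x 0) (homDist F G) :=
  rfl

/-- The homomorphism is built along the tree, by moving from the image of each parent to an
out-neighbour. -/
theorem Motif.IsRootedTree.exists_isHom (hF : F.IsRootedTree) (hout : ∀ a, ∃ b, 0 < G.A a b)
    (a : Fin n) : ∃ x : Fin k → Fin n, x 0 = a ∧ IsHom F G x := by
  obtain ⟨h01, hroot, hpar⟩ := hF
  choose next hnext using hout
  choose p hp hpe using hpar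
  let x : Fin k → Fin n := wellFounded_lt.fix fun i rec =>
    if h : i = 0 then a else next (rec (p i h) (hp i h))
  have hx : ∀ i, x i = if h : i = 0 then a else next (x (p i h)) := fun i =>
    wellFounded_lt.fix_eq _ i
  refine ⟨x, by rw [hx, dif_pos rfl], isHom_of_homWeight_pos (mul_pos
    (Finset.prod_pos fun i _ => Finset.prod_pos fun j _ => ?_)
    (Finset.prod_pos fun i _ => G.α_pos _))⟩
  rcases h01 i j with hij | hij
  · rw [hij, Real.rpow_zero]
    exact one_pos
  · have hj : j ≠ 0 := by
      rintro rfl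
      exact one_ne_zero (hij.symm.trans (hroot i))
    have hi : i = p j hj := (hpe j hj i).1 (hij ▸ one_pos)
    rw [hij, Real.rpow_one, hx j, dif_neg hj, ← hi]
    exact hnext _

theorem rootMarginal_pos_iff {a : Fin n} :
    0 < rootMarginal F G a ↔ ∃ x : Fin k → Fin n, x 0 = a ∧ IsHom F G x := by
  simp [rootMarginal, Finset.sum_pos_iff_of_nonneg fun x _ => homDist_nonneg F G x, IsHom]

end Root
end Pivot

end PivotChain

open PivotChain MeasureTheory Matrix in
theorem mainTheorem10_general {k n : ℕ} [NeZero k] (F : Motif k) (G : Network n)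
    (hroot : ∀ a, 0 < rootMarginal F G a) (hadj : ∀ a, ∃ b, 0 < max (G.A a b) (G.A b a))
    {Ω : Type*} [MeasurableSpace Ω] (μ : Measure Ω) [IsProbabilityMeasure μ]
    (X : ℕ → Ω → (Fin k → Fin n)) (hXm : ∀ t, Measurable (X t))
    (hX : IsMarkovChain μ (chainKernel F G) X)
    (g : (Fin k → Fin n) → ℝ) (c : ℝ) (hc : 0 < c)
    (hg : ∀ x y, IsHom F G x → IsHom F G y → |g x - g y| ≤ c)
    (δ : ℝ) (hδ : 0 < δ) (N : ℕ) (hN : 1 ≤ N) :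
    μ.real {ω | δ ≤ |homMean F G g - (1 / (N : ℝ)) * ∑ t ∈ Finset.Icc 1 N, g (X t ω)|} <
      2 * Real.exp (-(2 * δ ^ 2 * N) / (9 * c ^ 2) *
        ((mixingTime (rootKernel F G) (rootMarginal F G) (1 / 4) : ENNReal)⁻¹).toReal) := by
  obtain ⟨ω₀⟩ := μ.nonempty_of_neZero
  obtain ⟨x₀, -, hx₀⟩ := rootMarginal_pos_iff.1 (hroot (X 0 ω₀ 0))
  have hΨ := walkKernel_mem_rowStochastic hadj
  have hP : rootKernel F G ∈ rowStochastic ℝ (Fin n) :=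
    metropolisKernel_mem_rowStochastic hΨ fun a => (hroot a).le
  have hst : rootMarginal F G ᵥ* rootKernel F G = rootMarginal F G :=
    vecMul_metropolisKernel hΨ (fun a b => (walkKernel_eq_zero_comm hadj).1) hroot
  rw [chainKernel_eq_liftKernel] at hX
  exact hX.measureReal_average_deviation_lt_of_lift hXm hP (homDist_mem_stdSimplex hx₀)
    (fun a => (hroot a).ne') hst hc (fun x hx y hy => (abs_le.1 (hg x y hx hy)).2) hN hδ

theorem mainTheorem10 {k n : ℕ} [NeZero k] (hn : 2 ≤ n)
    (F : PivotChain.Motif k) (hF : F.IsRootedTree)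
    (G : PivotChain.Network n) (hG : G.IsIrreducible)
    (hout : ∀ a, ∃ b, 0 < G.A a b)
    {Ω : Type*} [MeasurableSpace Ω] (μ : MeasureTheory.Measure Ω)
    [MeasureTheory.IsProbabilityMeasure μ]
    (X : ℕ → Ω → (Fin k → Fin n)) (hXm : ∀ t, Measurable (X t))
    (hX0 : ∀ᵐ ω ∂μ, PivotChain.IsHom F G (X 0 ω))
    (hX : PivotChain.IsMarkovChain μ (PivotChain.chainKernel F G) X)
    (g : (Fin k → Fin n) → ℝ) (c : ℝ) (hc : 0 < c)
    (hg : ∀ x y, PivotChain.IsHom F G x → PivotChain.IsHom F G y → |g x - g y| ≤ c)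
    (δ : ℝ) (hδ : 0 < δ) (N : ℕ) (hN : 1 ≤ N) :
    μ.real {ω | δ ≤ |PivotChain.homMean F G g
        - (1 / (N : ℝ)) * ∑ t ∈ Finset.Icc 1 N, g (X t ω)|} <
      2 * Real.exp (-(2 * δ ^ 2 * N) / (9 * c ^ 2) *
        ((PivotChain.mixingTime (PivotChain.rootKernel F G)
          (PivotChain.rootMarginal F G) (1 / 4) : ENNReal)⁻¹).toReal) :=
  mainTheorem10_general F G
    (fun a => PivotChain.rootMarginal_pos_iff.2 (hF.exists_isHom hout a))
    (fun a => (hout a).imp fun _ => lt_max_of_lt_left) μ X hXm hX g c hc hg δ hδ N hN
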